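/- Fix a countable set of sorts $\alpha$. Simple types are generated from the base type $o$ of truth values and the sorts by forming function types $\sigma\tau$. For every type there are countably infinitely many variables; in addition there are the logical constants $\neg:oo$, $\to:ooo$, $=_\sigma:\sigma\sigma o$ for every type $\sigma$, and $\forall_\alpha:(\alpha o)o$ for every sort $\alpha$. Variables and logical constants together are the names. Terms are built from names by application $st$ and abstraction $\lambda x.t$ ($x$ a name); formulas are terms of type $o$; $s\neq_\sigma t$ stands for $\neg(s=_\sigma t)$. A frame $\mathcal D$ assigns to every type a nonempty set such that $\mathcal D(\sigma\tau)$ is a set of total functions from $\mathcal D\sigma$ to $\mathcal D\tau$; it is standard if $\mathcal D(\sigma\tau)$ is always the set of all such functions. An assignment $\mathcal I$ into $\mathcal D$ maps every name of type $\sigma$ to an element of $\mathcal D\sigma$. It is an interpretation if its evaluation function, where application is function application and $\lambda x.s$ has as its value the function $a\mapsto\widehat{\mathcal I^x_a}(s)$ provided that this belongs to the frame, is defined on all terms. It is logical if $\mathcal D o=\{0,1\}$ and the logical constants have their usual meaning ($\neg$ and $\to$ are negation and implication, $=_\sigma$ is the identity predicate on $\mathcal D\sigma$, and $\forall_\alpha$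 yields $1$ exactly on the constant function $1$). A model of a set $A$ of formulas is a logical interpretation that gives every member of $A$ the value $1$; $A$ is satisfiable if it has a model (in an arbitrary, not necessarily standard, frame). A term is EFO if the only logical constants it contains are $\neg$, $\to$, $=_\alpha$ and $\forall_\alpha$ with $\alpha$ a sort. A formula is quasi-EFO if it is EFO or of the form $s\neq_\sigma t$ with $s,t$ EFO terms of an arbitrary type $\sigma$. An EFO branch is a (possibly infinite) set of quasi-EFO formulas (normal or not). Statement. Every satisfiable EFO branch $A$ has a standard model, that is, a model whose frame $\mathcal D$ is standard, in which $\mathcal D\alpha$ is countable for every sort $\alpha$. -/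

import Mathlib

universe u v w

namespace STT

/-- Simple types over the base types: the truth values `o` and the sorts `α : S`. -/
inductive Ty (S : Type u) : Type u
  | o : Ty S
  | sort : S → Ty S
  | arr : Ty S → Ty S → Ty S

/-- Typed names, partitioned into the variables (`V σ` is the set of variables of type `σ`) and
the logical constants: negation, implication, identity at every type, and universal
quantification at every sort. -/
inductive Name {S : Type u} (V : Ty S → Type v) : Ty S → Type (max u v)
  | var {σ : Ty S} : V σ → Name V σ
  | neg : Name V (.arr .o .o)
  | imp : Name V (.arr .o (.arr .o .o))
  | eq (σ : Ty S) : Name V (.arr σ (.arr σ .o))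
  | all (α : S) : Name V (.arr (.arr (.sort α) .o) .o)

/-- Simply typed lambda terms with named binders. -/
inductive Term {S : Type u} (V : Ty S → Type v) : Ty S → Type (max u v)
  | name {σ : Ty S} : Name V σ → Term V σ
  | app {σ τ : Ty S} : Term V (.arr σ τ) → Term V σ → Term V τ
  | lam {σ τ : Ty S} : Name V σ → Term V τ → Term V (.arr σ τ)

/-- Formulas are the terms of type `o`. -/
abbrev Formula {S : Type u} (V : Ty S → Type v) : Type (max u v) := Term V .o

/-- The disequation `s ≠_σ t`, that is `¬ (s =_σ t)`. -/
def Term.neq {S : Type u} {V : Ty S → Type v} {σ : Ty S} (s t : Term V σ) : Formula V :=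
  .app (.name .neg) (.app (.app (.name (.eq σ)) s) t)

/-- The names allowed in EFO terms: all variables, `¬`, `→`, `=_α` and `∀_α` for sorts `α`. -/
def Name.IsEFO {S : Type u} {V : Ty S → Type v} : {σ : Ty S} → Name V σ → Prop
  | _, .var _ => True
  | _, .neg => True
  | _, .imp => True
  | _, .eq σ => ∃ α : S, σ = .sort α
  | _, .all _ => True

/-- A term is EFO if `¬`, `→`, `=_α` and `∀_α` are the only logical constants it contains. -/
def Term.IsEFO {S : Type u} {V : Ty S → Type v} : {σ : Ty S} → Term V σ → Prop
  | _, .name x => x.IsEFO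
  | _, .app s t => s.IsEFO ∧ t.IsEFO
  | _, .lam x s => x.IsEFO ∧ s.IsEFO

/-- A formula is quasi-EFO if it is EFO or a disequation, at an arbitrary type, of EFO terms. -/
def Term.IsQuasiEFO {S : Type u} {V : Ty S → Type v} (s : Formula V) : Prop :=
  s.IsEFO ∨ ∃ (σ : Ty S) (t r : Term V σ), t.IsEFO ∧ r.IsEFO ∧ s = t.neq r

/-- EFO branches: sets of quasi-EFO formulas. The formulas need not be normal, so this covers
the branches of normal formulas for every normalization operator. -/
def IsEFOBranch {S : Type u} {V : Ty S → Type v} (A : Set (Formula V)) : Prop :=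
  ∀ s ∈ A, s.IsQuasiEFO

/-- A frame: nonempty domains such that the elements of `dom (σ τ)` are total functions from
`dom σ` to `dom τ`; `app` takes an element to the function that it is, and
`app_injective` says that it is nothing but this function. -/
structure Frame (S : Type u) : Type (max u (w + 1)) where
  dom : Ty S → Type w
  nonempty : ∀ σ, Nonempty (dom σ)
  app : ∀ {σ τ : Ty S}, dom (.arr σ τ) → dom σ → dom τ
  app_injective : ∀ σ τ : Ty S, Function.Injective (app (σ := σ) (τ := τ))

/-- A frame is standard if `dom (σ τ)` consists of all functions from `dom σ` to `dom τ`. -/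
def Frame.IsStandard {S : Type u} (D : Frame.{u, w} S) : Prop :=
  ∀ σ τ : Ty S, Function.Surjective (D.app (σ := σ) (τ := τ))

/-- Assignments map every name of type `σ` to an element of `dom σ`. -/
abbrev Assignment {S : Type u} (V : Ty S → Type v) (D : Frame.{u, w} S) : Type (max u v w) :=
  (x : Σ σ : Ty S, Name V σ) → D.dom x.1

open Classical in
/-- The assignment that agrees with `I` except possibly on `x`, where it yields `a`. -/
noncomputable def Assignment.update {S : Type u} {V : Ty S → Type v} {D : Frame.{u, w} S}
    (I : Assignment V D) {σ : Ty S} (x : Name V σ) (a : D.dom σ) : Assignment V D :=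
  Function.update I ⟨σ, x⟩ a

/-- The graph of the (partial) evaluation function of an assignment: `Eval I s a` says that
the value of `s` under `I` is defined and equal to `a`. -/
def Eval {S : Type u} {V : Ty S → Type v} {D : Frame.{u, w} S} :
    {σ : Ty S} → Assignment V D → Term V σ → D.dom σ → Prop
  | σ, I, .name x, a => a = I ⟨σ, x⟩
  | _, I, .app s t, b => ∃ f a, Eval I s f ∧ Eval I t a ∧ b = D.app f a
  | _, I, .lam x s, f => ∀ a, Eval (I.update x a) s (D.app f a)

/-- Evaluation is single-valued. -/
theorem Eval.unique {S : Type u} {V : Ty S → Type v} {D : Frame.{u, w} S} {σ : Ty S}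
    (s : Term V σ) : ∀ (I : Assignment V D) (a b : D.dom σ), Eval I s a → Eval I s b → a = b := by
  induction s with
  | name x => intro I a b ha hb; exact Eq.trans ha (Eq.symm hb)
  | app s t ihs iht =>
    rintro I a b ⟨f, c, hf, hc, rfl⟩ ⟨g, d, hg, hd, rfl⟩
    rw [ihs I f g hf hg, iht I c d hc hd]
  | lam x s ih =>
    intro I f g hf hg
    exact D.app_injective _ _ (funext fun a => ih _ _ _ (hf a) (hg a))

/-- An interpretation is an assignment whose evaluation function is defined on all terms. -/
def Assignment.IsInterpretation {S : Type u} {V : Ty S → Type v} {D : Frame.{u, w} S}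
    (I : Assignment V D) : Prop :=
  ∀ (σ : Ty S) (s : Term V σ), ∃ a, Eval I s a

/-- A logical interpretation (Henkin structure): an interpretation `I` into a frame whose domain
at `o` is the set of the two truth values (identified with `Bool` through `truth`) such that the
logical constants have their usual meaning. -/
structure LogicalInterpretation {S : Type u} (V : Ty S → Type v) : Type (max u v (w + 1)) where
  frame : Frame.{u, w} S
  I : Assignment V frame
  isInterpretation : I.IsInterpretation
  truth : frame.dom .o ≃ Bool
  neg_spec : ∀ a : frame.dom .o, truth (frame.app (I ⟨_, .neg⟩) a) = !(truth a)
  imp_spec : ∀ a b : frame.dom .o,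
    truth (frame.app (frame.app (I ⟨_, .imp⟩) a) b) = true ↔ (truth a = true → truth b = true)
  eq_spec : ∀ (σ : Ty S) (a b : frame.dom σ),
    truth (frame.app (frame.app (I ⟨_, .eq σ⟩) a) b) = true ↔ a = b
  all_spec : ∀ (α : S) (f : frame.dom (.arr (.sort α) .o)),
    truth (frame.app (I ⟨_, .all α⟩) f) = true ↔ ∀ a, truth (frame.app f a) = true

/-- `M` satisfies the formula `s`: the value of `s` is the truth value `1`. -/
def LogicalInterpretation.Satisfies {S : Type u} {V : Ty S → Type v}
    (M : LogicalInterpretation.{u, v, w} V) (s : Formula V) : Prop :=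
  ∃ a, Eval M.I s a ∧ M.truth a = true

/-- `M` is a model of the set `A` of formulas. -/
def LogicalInterpretation.IsModel {S : Type u} {V : Ty S → Type v}
    (M : LogicalInterpretation.{u, v, w} V) (A : Set (Formula V)) : Prop :=
  ∀ s ∈ A, M.Satisfies s

/-- `A` has a (not necessarily standard) model, with domains in the universe `w`. -/
def Satisfiable {S : Type u} {V : Ty S → Type v} (A : Set (Formula V)) : Prop :=
  ∃ M : LogicalInterpretation.{u, v, w} V, M.IsModel A

end STT

namespace STT

open Set

/-! Downward Löwenheim–Skolem followed by a logical relation. In the given model, close the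
interpretation under update, evaluation, application and a choice of an argument at which two
distinct functions differ. The resulting part is countable (`countable_hull`), and its sorts
generate a standard frame. `Rel` links this frame to the part. It need not be total on standard
elements, but every element of the part has a partner and no standard element has two
(`rel_exists_unique`). The variables take partners of their old values, and the EFO constants are
related to their counterparts, so EFO terms have related values (`rel_eval`). Disequations at any
type survive because equal standard values force equal values in the old model. The converse may
fail at higher types, since one element can have several standard partners. -/

/-! ### Countability of the syntax -/

theorem Ty.countable {S : Type u} [Countable S] : Countable (Ty S) := by
  let T : ℕ → Set (Ty S) := fun n =>
    n.rec (insert .o (range .sort)) fun _ X => X ∪ image2 .arr X X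
  have hT : ∀ n, (T n).Countable := by
    intro n
    induction n with
    | zero => exact (countable_range _).insert _
    | succ n ih => exact ih.union (ih.image2 ih _)
  have hmono : Monotone T := monotone_nat_of_le_succ fun n => subset_union_left
  have hmem : ∀ σ : Ty S, ∃ n, σ ∈ T n := by
    intro σ
    induction σ with
    | o => exact ⟨0, mem_insert _ _⟩
    | sort α => exact ⟨0, mem_insert_of_mem _ (mem_range_self α)⟩
    | arr σ τ ihσ ihτ =>
      obtain ⟨m, hm⟩ := ihσ
      obtain ⟨n, hn⟩ := ihτ
      exact ⟨max m n + 1, Or.inr (mem_image2_of_mem (hmono (le_max_left m n) hm)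
        (hmono (le_max_right m n) hn))⟩
  exact countable_univ_iff.1 ((countable_iUnion hT).mono fun σ _ => mem_iUnion.2 (hmem σ))

theorem Name.countable {S : Type u} {V : Ty S → Type v} [∀ σ, Countable (V σ)] (σ : Ty S) :
    Countable (Name V σ) := by
  let f : {σ : Ty S} → Name V σ → V σ ⊕ Fin 4 := fun x => match x with
    | .var x => .inl x
    | .neg => .inr 0
    | .imp => .inr 1
    | .eq _ => .inr 2
    | .all _ => .inr 3
  have hf : Function.Injective (f (σ := σ)) := by
    intro x y h
    cases x <;> cases y <;> simp_all [f]
  exact hf.countable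

theorem Term.countable {S : Type u} [Countable S] {V : Ty S → Type v} [∀ σ, Countable (V σ)]
    (σ : Ty S) : Countable (Term V σ) := by
  have := Ty.countable (S := S)
  have := Name.countable (V := V)
  let T : ℕ → ∀ σ, Set (Term V σ) := fun n =>
    n.rec (fun _ => range .name) fun _ X σ =>
      X σ ∪ ((⋃ τ, image2 .app (X (.arr τ σ)) (X τ)) ∪
        {s | ∃ (τ ρ : Ty S) (x : Name V τ) (t : Term V ρ) (h : Ty.arr τ ρ = σ),
          t ∈ X ρ ∧ s = h ▸ Term.lam x t})
  have hT : ∀ n σ, (T n σ).Countable := by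
    intro n
    induction n with
    | zero => exact fun σ => countable_range _
    | succ n ih =>
      intro σ
      refine (ih σ).union ((countable_iUnion fun τ => (ih _).image2 (ih _) _).union ?_)
      -- Abstractions have function types only, so they contribute nothing at `o` and at sorts.
      cases σ with
      | o => exact countable_empty.mono fun s ⟨_, _, _, _, h, _⟩ => nomatch h
      | sort α => exact countable_empty.mono fun s ⟨_, _, _, _, h, _⟩ => nomatch h
      | arr τ ρ =>
        refine ((countable_univ (α := Name V τ)).image2 (ih ρ) Term.lam).mono ?_
        rintro s ⟨_, _, x, t, h, ht, rfl⟩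
        cases h
        exact mem_image2_of_mem (mem_univ x) ht
  have hmono : Monotone T := monotone_nat_of_le_succ fun n σ => subset_union_left
  have hmem : ∀ {σ : Ty S} (s : Term V σ), ∃ n, s ∈ T n σ := by
    intro σ s
    induction s with
    | name x => exact ⟨0, mem_range_self x⟩
    | app s t ihs iht =>
      obtain ⟨m, hm⟩ := ihs
      obtain ⟨n, hn⟩ := iht
      exact ⟨max m n + 1, Or.inr (Or.inl (mem_iUnion.2 ⟨_, mem_image2_of_mem
        (hmono (le_max_left m n) _ hm) (hmono (le_max_right m n) _ hn)⟩))⟩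
    | lam x s ih =>
      obtain ⟨n, hn⟩ := ih
      exact ⟨n + 1, Or.inr (Or.inr ⟨_, _, x, s, rfl, hn, rfl⟩)⟩
  exact countable_univ_iff.1
    ((countable_iUnion fun n => hT n σ).mono fun s _ => mem_iUnion.2 (hmem s))

/-! ### Assignments and evaluation in standard frames -/

theorem Assignment.update_same {S : Type u} {V : Ty S → Type v} {D : Frame.{u, w} S}
    (I : Assignment V D) {σ : Ty S} (x : Name V σ) (a : D.dom σ) : I.update x a ⟨σ, x⟩ = a := by
  simp [Assignment.update]

theorem Assignment.update_of_ne {S : Type u} {V : Ty S → Type v} {D : Frame.{u, w} S}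
    (I : Assignment V D) {σ τ : Ty S} {x : Name V σ} {y : Name V τ} (a : D.dom σ)
    (h : (⟨τ, y⟩ : Σ σ, Name V σ) ≠ ⟨σ, x⟩) : I.update x a ⟨τ, y⟩ = I ⟨τ, y⟩ := by
  classical exact Function.update_of_ne h _ _

/-- Every assignment into a standard frame is an interpretation. -/
theorem Frame.IsStandard.isInterpretation {S : Type u} {V : Ty S → Type v} {D : Frame.{u, w} S}
    (hD : D.IsStandard) (I : Assignment V D) : I.IsInterpretation := by
  intro σ s
  induction s generalizing I with
  | name x => exact ⟨_, rfl⟩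
  | app s t ihs iht =>
    obtain ⟨f, hf⟩ := ihs I
    obtain ⟨a, ha⟩ := iht I
    exact ⟨_, f, a, hf, ha, rfl⟩
  | lam x s ih =>
    choose v hv using fun a => ih (I.update x a)
    obtain ⟨f, rfl⟩ := hD _ _ v
    exact ⟨f, hv⟩

/-! ### Countable Skolem hulls -/

/-- An argument at which `f` and `g` differ, if there is one. -/
noncomputable def Frame.separator {S : Type u} (D : Frame.{u, w} S) {σ τ : Ty S}
    (f g : D.dom (.arr σ τ)) : D.dom σ :=
  @Classical.epsilon _ (D.nonempty σ) fun a => D.app f a ≠ D.app g a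

theorem Frame.separator_spec {S : Type u} (D : Frame.{u, w} S) {σ τ : Ty S}
    {f g : D.dom (.arr σ τ)} (h : f ≠ g) :
    D.app f (D.separator f g) ≠ D.app g (D.separator f g) :=
  Classical.epsilon_spec (p := fun a => D.app f a ≠ D.app g a)
    (Function.ne_iff.1 fun e => h (D.app_injective _ _ e))

/-- A set of assignments together with a set of elements of every type. -/
structure Part {S : Type u} (V : Ty S → Type v) (D : Frame.{u, w} S) : Type (max u v w) where
  asg : Set (Assignment V D)
  elt : ∀ σ, Set (D.dom σ)

namespace Part

variable {S : Type u} {V : Ty S → Type v} {D : Frame.{u, w} S}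

/-- A part is a Skolem part if it is closed under update, evaluation, application and
separation of distinct functions. -/
structure IsSkolem (P : Part V D) : Prop where
  update_mem : ∀ {σ} {J : Assignment V D} (x : Name V σ) {a : D.dom σ},
    J ∈ P.asg → a ∈ P.elt σ → J.update x a ∈ P.asg
  eval_mem : ∀ {σ} {J : Assignment V D} {s : Term V σ} {a : D.dom σ},
    J ∈ P.asg → Eval J s a → a ∈ P.elt σ
  app_mem : ∀ {σ τ} {f : D.dom (.arr σ τ)} {a : D.dom σ},
    f ∈ P.elt _ → a ∈ P.elt _ → D.app f a ∈ P.elt τ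
  separator_mem : ∀ {σ τ} {f g : D.dom (.arr σ τ)},
    f ∈ P.elt _ → g ∈ P.elt _ → D.separator f g ∈ P.elt σ

/-- One step of the closure of a part under the operations of `IsSkolem`. -/
def next (P : Part V D) : Part V D where
  asg := P.asg ∪ ⋃ (σ : Ty S) (x : Name V σ),
    image2 (fun J a => Assignment.update J x a) P.asg (P.elt σ)
  elt σ := P.elt σ ∪ ((⋃ J ∈ P.asg, ⋃ s : Term V σ, {a | Eval J s a}) ∪
    ((⋃ τ, image2 D.app (P.elt (.arr τ σ)) (P.elt τ)) ∪
      ⋃ τ, image2 D.separator (P.elt (.arr σ τ)) (P.elt (.arr σ τ))))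

/-- The stages of the closure of an assignment under the operations of `IsSkolem`. -/
def stage (I : Assignment V D) (n : ℕ) : Part V D :=
  n.rec ⟨{I}, fun _ => ∅⟩ fun _ P => P.next

/-- The closure of an assignment under the operations of `IsSkolem`. -/
def hull (I : Assignment V D) : Part V D where
  asg := ⋃ n, (stage I n).asg
  elt σ := ⋃ n, (stage I n).elt σ

/-- Each step adds countably many images; evaluation adds at most one value for each pair of an
assignment and a term. -/
theorem countable_stage [Countable S] [∀ σ, Countable (V σ)] (I : Assignment V D) (n : ℕ) :
    (stage I n).asg.Countable ∧ ∀ σ, ((stage I n).elt σ).Countable := by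
  have := Ty.countable (S := S)
  have := Name.countable (V := V)
  have := Term.countable (V := V)
  induction n with
  | zero => exact ⟨countable_singleton I, fun _ => countable_empty⟩
  | succ n ih =>
    obtain ⟨hA, hE⟩ := ih
    refine ⟨hA.union (countable_iUnion fun σ => countable_iUnion fun x => hA.image2 (hE σ) _),
      fun σ => (hE σ).union (Countable.union ?_ (Countable.union ?_ ?_))⟩
    · exact hA.biUnion fun J _ => countable_iUnion fun s =>
        Set.Subsingleton.countable fun a ha b hb => Eval.unique s J a b ha hb
    · exact countable_iUnion fun τ => (hE _).image2 (hE _) _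
    · exact countable_iUnion fun τ => (hE _).image2 (hE _) _

theorem countable_hull [Countable S] [∀ σ, Countable (V σ)] (I : Assignment V D) (σ : Ty S) :
    ((hull I).elt σ).Countable :=
  countable_iUnion fun n => (countable_stage I n).2 σ

theorem self_mem_hull (I : Assignment V D) : I ∈ (hull I).asg :=
  mem_iUnion.2 ⟨0, mem_singleton I⟩

theorem monotone_stage_asg (I : Assignment V D) : Monotone fun n => (stage I n).asg :=
  monotone_nat_of_le_succ fun _ => subset_union_left

theorem monotone_stage_elt (I : Assignment V D) (σ : Ty S) :
    Monotone fun n => (stage I n).elt σ :=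
  monotone_nat_of_le_succ fun _ => subset_union_left

theorem isSkolem_hull (I : Assignment V D) : (hull I).IsSkolem where
  update_mem := by
    intro σ J x a hJ ha
    obtain ⟨m, hm⟩ := mem_iUnion.1 hJ
    obtain ⟨n, hn⟩ := mem_iUnion.1 ha
    exact mem_iUnion.2 ⟨max m n + 1, Or.inr (mem_iUnion₂.2 ⟨σ, x, mem_image2_of_mem
      (monotone_stage_asg I (le_max_left m n) hm)
      (monotone_stage_elt I _ (le_max_right m n) hn)⟩)⟩
  eval_mem := by
    intro σ J s a hJ ha
    obtain ⟨m, hm⟩ := mem_iUnion.1 hJ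
    exact mem_iUnion.2 ⟨m + 1, Or.inr (Or.inl (mem_iUnion₂.2 ⟨J, hm, mem_iUnion.2 ⟨s, ha⟩⟩))⟩
  app_mem := by
    intro σ τ f a hf ha
    obtain ⟨m, hm⟩ := mem_iUnion.1 hf
    obtain ⟨n, hn⟩ := mem_iUnion.1 ha
    exact mem_iUnion.2 ⟨max m n + 1, Or.inr (Or.inr (Or.inl (mem_iUnion.2 ⟨σ, mem_image2_of_mem
      (monotone_stage_elt I _ (le_max_left m n) hm)
      (monotone_stage_elt I _ (le_max_right m n) hn)⟩)))⟩
  separator_mem := by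
    intro σ τ f g hf hg
    obtain ⟨m, hm⟩ := mem_iUnion.1 hf
    obtain ⟨n, hn⟩ := mem_iUnion.1 hg
    exact mem_iUnion.2 ⟨max m n + 1, Or.inr (Or.inr (Or.inr (mem_iUnion.2 ⟨τ, mem_image2_of_mem
      (monotone_stage_elt I _ (le_max_left m n) hm)
      (monotone_stage_elt I _ (le_max_right m n) hn)⟩)))⟩

theorem IsSkolem.name_mem {P : Part V D} (hP : P.IsSkolem) {J : Assignment V D} (hJ : J ∈ P.asg)
    {σ : Ty S} (x : Name V σ) : J ⟨σ, x⟩ ∈ P.elt σ :=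
  hP.eval_mem (s := .name x) hJ rfl

end Part

/-! ### Standard interpretations -/

/-- The domains of the standard frame over given domains of the sorts. -/
def StdDom {S : Type u} (B : S → Type w) : Ty S → Type w
  | .o => ULift Bool
  | .sort α => B α
  | .arr σ τ => StdDom B σ → StdDom B τ

theorem StdDom.nonempty {S : Type u} {B : S → Type w} [∀ α, Nonempty (B α)] :
    ∀ σ, Nonempty (StdDom B σ)
  | .o => ⟨⟨true⟩⟩
  | .sort α => inferInstanceAs (Nonempty (B α))
  | .arr _ τ => (StdDom.nonempty τ).map fun b _ => b

/-- The standard frame over given nonempty domains of the sorts. -/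
def stdFrame {S : Type u} (B : S → Type w) [∀ α, Nonempty (B α)] : Frame.{u, w} S where
  dom := StdDom B
  nonempty := StdDom.nonempty
  app f a := f a
  app_injective _ _ := fun _ _ h => h

theorem stdFrame_isStandard {S : Type u} (B : S → Type w) [∀ α, Nonempty (B α)] :
    (stdFrame B).IsStandard :=
  fun _ _ f => ⟨f, rfl⟩

open Classical in
/-- The assignment into the standard frame with given values of the variables that gives the
logical constants their usual meaning. -/
noncomputable def stdAssignment {S : Type u} {V : Ty S → Type v} {B : S → Type w}
    [∀ α, Nonempty (B α)] (val : ∀ σ, V σ → StdDom B σ) : Assignment V (stdFrame B)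
  | ⟨σ, .var x⟩ => val σ x
  | ⟨_, .neg⟩ => fun a : ULift Bool => (⟨!a.down⟩ : ULift Bool)
  | ⟨_, .imp⟩ => fun a b : ULift Bool => (⟨!a.down || b.down⟩ : ULift Bool)
  | ⟨_, .eq σ⟩ => fun a b : StdDom B σ => (⟨decide (a = b)⟩ : ULift Bool)
  | ⟨_, .all α⟩ => fun f : B α → ULift Bool => (⟨decide (∀ a, (f a).down = true)⟩ : ULift Bool)

/-- The standard logical interpretation with given values of the variables. -/
noncomputable def stdInterpretation {S : Type u} {V : Ty S → Type v} {B : S → Type w}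
    [∀ α, Nonempty (B α)] (val : ∀ σ, V σ → StdDom B σ) : LogicalInterpretation.{u, v, w} V where
  frame := stdFrame B
  I := stdAssignment val
  isInterpretation := (stdFrame_isStandard B).isInterpretation _
  truth := (Equiv.ulift : ULift Bool ≃ Bool)
  neg_spec _ := rfl
  imp_spec := by
    rintro ⟨a⟩ ⟨b⟩
    change (!a || b) = true ↔ (a = true → b = true)
    cases a <;> simp
  eq_spec _ _ _ := @decide_eq_true_iff _ (Classical.propDecidable _)
  all_spec _ _ := @decide_eq_true_iff _ (Classical.propDecidable _)

/-! ### The logical relation and transfer of truth -/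

section Transfer

variable {S : Type u} {V : Ty S → Type v} (M : LogicalInterpretation.{u, v, w} V)
  (P : Part V M.frame) {B : S → Type*} (e : ∀ α, B α ≃ P.elt (.sort α))

/-- The logical relation between the standard frame over the sorts of a part of `M` and that
part. -/
def Rel : (σ : Ty S) → StdDom B σ → M.frame.dom σ → Prop
  | .o, a, b => b ∈ P.elt .o ∧ a.down = M.truth b
  | .sort α, a, b => (e α a : M.frame.dom (.sort α)) = b
  | .arr σ τ, f, g => g ∈ P.elt (.arr σ τ) ∧ ∀ a b, Rel σ a b → Rel τ (f a) (M.frame.app g b)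

variable {M P e}

theorem Rel.mem {σ : Ty S} {a : StdDom B σ} {b : M.frame.dom σ} (h : Rel M P e σ a b) :
    b ∈ P.elt σ := by
  cases σ with
  | o => exact h.1
  | sort α => exact h ▸ (e α a).2
  | arr σ τ => exact h.1

/-- The logical relation is the graph of a partial map onto the part. -/
theorem rel_exists_unique [∀ α, Nonempty (B α)] (hP : P.IsSkolem) (σ : Ty S) :
    (∀ b ∈ P.elt σ, ∃ a, Rel M P e σ a b) ∧
      ∀ a b b', Rel M P e σ a b → Rel M P e σ a b' → b = b' := by
  induction σ with
  | o =>
    exact ⟨fun b hb => ⟨⟨M.truth b⟩, hb, rfl⟩, fun a b b' h h' =>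
      M.truth.injective (h.2.symm.trans h'.2)⟩
  | sort α =>
    exact ⟨fun b hb => ⟨(e α).symm ⟨b, hb⟩, by simp [Rel]⟩, fun a b b' h h' => h.symm.trans h'⟩
  | arr σ τ ihσ ihτ =>
    constructor
    · intro g hg
      have : ∀ a : StdDom B σ, ∃ c : StdDom B τ,
          ∀ b, Rel M P e σ a b → Rel M P e τ c (M.frame.app g b) := by
        intro a
        -- An argument without partner imposes no condition, so any value will do; otherwise its
        -- partner is unique and dictates the value.
        by_cases h : ∃ b, Rel M P e σ a b
        · obtain ⟨b, hb⟩ := h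
          obtain ⟨c, hc⟩ := ihτ.1 _ (hP.app_mem hg hb.mem)
          exact ⟨c, fun b' hb' => ihσ.2 a b b' hb hb' ▸ hc⟩
        · obtain ⟨c⟩ := StdDom.nonempty (B := B) τ
          exact ⟨c, fun b hb => absurd ⟨b, hb⟩ h⟩
      choose f hf using this
      exact ⟨f, hg, hf⟩
    · intro f g g' h h'
      -- The separator of `g` and `g'` lies in the part, so it has a standard partner `a`; the value
      -- of `f` at `a` would then have two distinct partners.
      by_contra hne
      obtain ⟨a, ha⟩ := ihσ.1 _ (hP.separator_mem h.1 h'.1)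
      exact M.frame.separator_spec hne (ihτ.2 _ _ _ (h.2 _ _ ha) (h'.2 _ _ ha))

/-- Related assignments give related values to EFO terms. -/
theorem rel_eval [∀ α, Nonempty (B α)] (hP : P.IsSkolem) {σ : Ty S} (s : Term V σ)
    (hs : s.IsEFO) {J : Assignment V (stdFrame B)} {K : Assignment V M.frame} (hK : K ∈ P.asg)
    (hJK : ∀ (τ : Ty S) (x : Name V τ), x.IsEFO → Rel M P e τ (J ⟨τ, x⟩) (K ⟨τ, x⟩))
    {a : StdDom B σ} {b : M.frame.dom σ} (ha : Eval (D := stdFrame B) J s a) (hb : Eval K s b) :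
    Rel M P e σ a b := by
  induction s generalizing J K with
  | name x =>
    cases ha
    cases hb
    exact hJK _ x hs
  | app s t ihs iht =>
    obtain ⟨f, c, hf, hc, rfl⟩ := ha
    obtain ⟨g, d, hg, hd, rfl⟩ := hb
    exact (ihs hs.1 hK hJK hf hg).2 _ _ (iht hs.2 hK hJK hc hd)
  | lam x s ih =>
    refine ⟨hP.eval_mem hK hb, fun c d hcd => ?_⟩
    refine ih hs.2 (hP.update_mem x hK hcd.mem) (fun τ y hy => ?_) (ha c) (hb d)
    by_cases h : (⟨τ, y⟩ : Σ σ, Name V σ) = ⟨_, x⟩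
    · cases h
      exact (congrArg₂ (Rel M P e _) (Assignment.update_same (D := stdFrame B) J x c)
        (K.update_same x d)).mpr hcd
    · exact (congrArg₂ (Rel M P e τ) (Assignment.update_of_ne (D := stdFrame B) J c h)
        (K.update_of_ne d h)).mpr (hJK τ y hy)

/-- A predicate on a sort that holds on the elements of a Skolem part holds everywhere. -/
theorem forall_of_forall_mem [∀ σ, Nonempty (V σ)] (hP : P.IsSkolem) (hI : M.I ∈ P.asg) {α : S}
    {g : M.frame.dom (.arr (.sort α) .o)} (hg : g ∈ P.elt _)
    (h : ∀ a ∈ P.elt (.sort α), M.truth (M.frame.app g a) = true) (a : M.frame.dom (.sort α)) :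
    M.truth (M.frame.app g a) = true := by
  obtain ⟨x⟩ := ‹∀ σ, Nonempty (V σ)› (.sort α)
  -- The constantly true function, definable as `λx. x = x` and hence in the part. If `g` differed
  -- from it, a separator in the part would witness this, against `h`.
  obtain ⟨t, ht⟩ := M.isInterpretation _ (.lam (.var x)
    (.app (.app (.name (.eq (.sort α))) (.name (.var x))) (.name (.var x))))
  have htrue : ∀ a, M.truth (M.frame.app t a) = true := by
    intro a
    obtain ⟨_, c, ⟨_, d, rfl, rfl, rfl⟩, rfl, hta⟩ := ht a
    rw [hta, Assignment.update_same, Assignment.update_of_ne _ _ (by simp)]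
    exact (M.eq_spec _ _ _).2 rfl
  have hgt : g = t := by
    by_contra hne
    refine M.frame.separator_spec hne (M.truth.injective ?_)
    rw [h _ (hP.separator_mem hg (hP.eval_mem hI ht)), htrue]
  exact hgt ▸ htrue a

/-- The standard interpretation is related to `M` on EFO names if it is on variables. -/
theorem rel_stdAssignment [∀ σ, Nonempty (V σ)] [∀ α, Nonempty (B α)] (hP : P.IsSkolem)
    (hI : M.I ∈ P.asg) (val : ∀ σ, V σ → StdDom B σ)
    (hval : ∀ σ x, Rel M P e σ (val σ x) (M.I ⟨σ, .var x⟩)) (σ : Ty S) (x : Name V σ)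
    (hx : x.IsEFO) : Rel M P e σ (stdAssignment val ⟨σ, x⟩) (M.I ⟨σ, x⟩) := by
  have hn : ∀ {σ : Ty S} (x : Name V σ), M.I ⟨σ, x⟩ ∈ P.elt σ := hP.name_mem hI
  cases x with
  | var x => exact hval _ x
  | neg =>
    refine ⟨hn _, fun a b hab => ⟨hP.app_mem (hn _) hab.mem, ?_⟩⟩
    rw [M.neg_spec, ← hab.2]
    rfl
  | imp =>
    refine ⟨hn _, fun a b hab => ⟨hP.app_mem (hn _) hab.mem, fun c d hcd =>
      ⟨hP.app_mem (hP.app_mem (hn _) hab.mem) hcd.mem, ?_⟩⟩⟩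
    rw [Bool.eq_iff_iff, M.imp_spec, ← hab.2, ← hcd.2]
    change (!a.down || c.down) = true ↔ _
    cases a.down <;> simp
  | eq σ =>
    -- At a sort the relation is the graph of an injection, so identity is reflected in both
    -- directions.
    obtain ⟨α, rfl⟩ := hx
    refine ⟨hn _, fun a b hab => ⟨hP.app_mem (hn _) hab.mem, fun c d hcd =>
      ⟨hP.app_mem (hP.app_mem (hn _) hab.mem) hcd.mem, ?_⟩⟩⟩
    rw [Bool.eq_iff_iff, M.eq_spec]
    refine (@decide_eq_true_iff _ (Classical.propDecidable _)).trans ?_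
    rw [← show _ = b from hab, ← show _ = d from hcd]
    exact ((Subtype.val_injective.comp (e α).injective).eq_iff (a := a) (b := c)).symm
  | all α =>
    refine ⟨hn _, fun f g hfg => ⟨hP.app_mem (hn _) hfg.mem, ?_⟩⟩
    rw [Bool.eq_iff_iff, M.all_spec]
    refine (@decide_eq_true_iff _ (Classical.propDecidable _)).trans ⟨fun h => ?_, fun h a => ?_⟩
    -- The old quantifier also ranges over elements outside the part.
    · refine forall_of_forall_mem hP hI hfg.mem fun b hb => ?_
      obtain ⟨a, ha⟩ := (rel_exists_unique (e := e) hP (.sort α)).1 b hb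
      rw [← (hfg.2 a b ha).2]
      exact h a
    · exact (hfg.2 a _ rfl).2.trans (h _)

/-- The standard interpretation inherits the truth of quasi-EFO formulas. -/
theorem satisfies_stdInterpretation [∀ α, Nonempty (B α)] (hP : P.IsSkolem) (hI : M.I ∈ P.asg)
    (val : ∀ σ, V σ → StdDom B σ)
    (hval : ∀ (σ : Ty S) (x : Name V σ), x.IsEFO →
      Rel M P e σ (stdAssignment val ⟨σ, x⟩) (M.I ⟨σ, x⟩))
    {s : Formula V} (hs : s.IsQuasiEFO) (hM : M.Satisfies s) :
    (stdInterpretation val).Satisfies s := by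
  obtain ⟨b, hb, htrue⟩ := hM
  obtain ⟨a, ha⟩ := (stdInterpretation val).isInterpretation _ s
  refine ⟨a, ha, ?_⟩
  rcases hs with hs | ⟨σ, t, r, ht, hr, rfl⟩
  · exact (rel_eval hP s hs hI hval ha hb).2.trans htrue
  · obtain ⟨_, _, rfl, ⟨_, c, ⟨_, d, rfl, hd, rfl⟩, hc, rfl⟩, rfl⟩ := hb
    obtain ⟨_, _, rfl, ⟨_, c', ⟨_, d', rfl, hd', rfl⟩, hc', rfl⟩, rfl⟩ := ha
    rw [LogicalInterpretation.neg_spec, Bool.not_eq_true', ← Bool.not_eq_true,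
      LogicalInterpretation.eq_spec] at htrue ⊢
    rintro rfl
    exact htrue ((rel_exists_unique hP σ).2 _ _ _ (rel_eval hP t ht hI hval hd' hd)
      (rel_eval hP r hr hI hval hc' hc))

end Transfer

end STT

theorem mainTheorem9 {S : Type u} [Countable S] (V : STT.Ty S → Type v)
    [∀ σ, Countable (V σ)] [∀ σ, Infinite (V σ)]
    (A : Set (STT.Formula V)) (hA : STT.IsEFOBranch A) (hsat : STT.Satisfiable.{u, v, w} A) :
    ∃ M : STT.LogicalInterpretation.{u, v, 0} V,
      M.frame.IsStandard ∧ M.IsModel A ∧ ∀ α : S, Countable (M.frame.dom (.sort α)) := by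
  obtain ⟨M, hM⟩ := hsat
  let P := STT.Part.hull M.I
  have hP : P.IsSkolem := STT.Part.isSkolem_hull M.I
  have hI : M.I ∈ P.asg := STT.Part.self_mem_hull M.I
  have hcount : ∀ α, Countable (P.elt (.sort α)) := fun α =>
    (STT.Part.countable_hull M.I _).to_subtype
  -- Countable sets have copies in the lowest universe.
  let B : S → Type := fun α => Shrink.{0} (P.elt (.sort α))
  let e : ∀ α, B α ≃ P.elt (.sort α) := fun α => (equivShrink _).symm
  have hB : ∀ α, Nonempty (B α) := fun α =>
    let ⟨x⟩ := (inferInstance : Nonempty (V (.sort α)))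
    ⟨(e α).symm ⟨_, hP.name_mem hI (.var x)⟩⟩
  choose val hval using fun (σ : STT.Ty S) (x : V σ) =>
    (STT.rel_exists_unique (e := e) hP σ).1 _ (hP.name_mem hI (.var x))
  exact ⟨STT.stdInterpretation val, STT.stdFrame_isStandard B,
    fun s hs => STT.satisfies_stdInterpretation hP hI val
      (STT.rel_stdAssignment hP hI val hval) (hA s hs) (hM s hs),
    fun α => (e α).injective.countable⟩
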